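/- Let $\mathbb D$ be the open unit disk in $\mathbb C$, and let $\mathcal A$ be a complex unital Banach algebra with $\|1_{\mathcal A}\|=1$ and group of invertible elements $\mathcal A_*$. Let $\{F_t\}_{t\ge 0}$ be a continuous semigroup of holomorphic self-maps of $\mathbb D$ (that is, $(t,z)\mapsto F_t(z)$ is continuous on $[0,\infty)\times\mathbb D$, $F_{t+s}=F_t\circ F_s$ and $F_0=\mathrm{id}$), generated by the holomorphic function $f:\mathbb D\to\mathbb C$, $f(z)=\lim_{t\to0^+}\frac{F_t(z)-z}{t}$. Suppose that $f(z_0)=0$ for some $z_0\in\mathbb D$ and that $\lambda:=-f'(z_0)$ satisfies $\operatorname{Re}\lambda>0$. Let $\{\Gamma_t\}_{t\ge0}$ be a holomorphic semicocycle over $\{F_t\}$, i.e. each $\Gamma_t:\mathbb D\to\mathcal A$ is holomorphic, $(t,z)\mapsto\Gamma_t(z)$ is continuous on $[0,\infty)\times\mathbb D$, $\Gamma_t(F_s(z))\Gamma_s(z)=\Gamma_{t+s}(z)$ and $\Gamma_0(z)=1_{\mathcal A}$ for all $t,s\ge0$, $z\in\mathbb D$. Then the one-sided derivative $B_0:=\frac{d}{dt}\Gamma_t(z_0)\big|_{t=0}$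 exists. Let $\operatorname{ad}_{B_0}:\mathcal A\to\mathcal A$ be the bounded operator $\operatorname{ad}_{B_0}(a)=aB_0-B_0a$. If $$\sigma(\operatorname{ad}_{B_0})\cap\{k\lambda: k=1,2,3,\dots\}=\emptyset,$$ then there is a holomorphic $M:\mathbb D\to\mathcal A$ with values in $\mathcal A_*$ such that $$\Gamma_t(z)=M(F_t(z))^{-1}e^{tB_0}M(z)\qquad\text{for all } t\ge0,\ z\in\mathbb D.$$ -/

import Mathlib

/-- A one-parameter continuous semigroup of holomorphic self-maps of the open unit disk.
Only the values `F t z` with `0 ≤ t` and `z` in the disk matter. -/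
structure IsHolSemigroup (F : ℝ → ℂ → ℂ) : Prop where
  mapsTo : ∀ t : ℝ, 0 ≤ t → Set.MapsTo (F t) (Metric.ball (0 : ℂ) 1) (Metric.ball (0 : ℂ) 1)
  holomorphic : ∀ t : ℝ, 0 ≤ t → DifferentiableOn ℂ (F t) (Metric.ball (0 : ℂ) 1)
  continuousOn : ContinuousOn (fun p : ℝ × ℂ => F p.1 p.2)
    (Set.Ici (0 : ℝ) ×ˢ Metric.ball (0 : ℂ) 1)
  add : ∀ t s : ℝ, 0 ≤ t → 0 ≤ s → ∀ z ∈ Metric.ball (0 : ℂ) 1, F (t + s) z = F t (F s z)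
  zero : ∀ z ∈ Metric.ball (0 : ℂ) 1, F 0 z = z

/-- `f` is the (holomorphic) infinitesimal generator of the family `F` on the unit disk:
`f z` is the limit of `(F t z - z) / t` as `t → 0⁺`. -/
structure IsHolGenerator (F : ℝ → ℂ → ℂ) (f : ℂ → ℂ) : Prop where
  holomorphic : DifferentiableOn ℂ f (Metric.ball (0 : ℂ) 1)
  tendsto : ∀ z ∈ Metric.ball (0 : ℂ) 1,
    Filter.Tendsto (fun t : ℝ => (F t z - z) / (t : ℂ)) (nhdsWithin 0 (Set.Ioi 0)) (nhds (f z))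

/-- A holomorphic semicocycle over `F` with values in the Banach algebra `A`. -/
structure IsHolSemicocycle {A : Type*} [NormedRing A] [NormedAlgebra ℂ A]
    (F : ℝ → ℂ → ℂ) (Γ : ℝ → ℂ → A) : Prop where
  holomorphic : ∀ t : ℝ, 0 ≤ t → DifferentiableOn ℂ (Γ t) (Metric.ball (0 : ℂ) 1)
  continuousOn : ContinuousOn (fun p : ℝ × ℂ => Γ p.1 p.2)
    (Set.Ici (0 : ℝ) ×ˢ Metric.ball (0 : ℂ) 1)
  chain : ∀ t s : ℝ, 0 ≤ t → 0 ≤ s → ∀ z ∈ Metric.ball (0 : ℂ) 1,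
    Γ t (F s z) * Γ s z = Γ (t + s) z
  zero : ∀ z ∈ Metric.ball (0 : ℂ) 1, Γ 0 z = 1

/-- The generator of a semicocycle: the one-sided derivative of `t ↦ Γ t z` at `t = 0`. -/
noncomputable def semicocycleGenerator {A : Type*} [NormedRing A] [NormedAlgebra ℂ A]
    (Γ : ℝ → ℂ → A) (z : ℂ) : A :=
  derivWithin (fun t : ℝ => Γ t z) (Set.Ici 0) 0

/-- The bounded operator `a ↦ a * b - b * a` on `A`. -/
noncomputable def adOp {A : Type*} [NormedRing A] [NormedAlgebra ℂ A] (b : A) : A →L[ℂ] A :=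
  (ContinuousLinearMap.mul ℂ A).flip b - ContinuousLinearMap.mul ℂ A b

theorem adOp_apply {A : Type*} [NormedRing A] [NormedAlgebra ℂ A] (b a : A) :
    adOp b a = a * b - b * a := by
  simp [adOp]

/-- `M` is a holomorphic map from the disk to the invertible elements of `A` with
`Γ t z = (M (F t z))⁻¹ * exp (t b) * M z`. -/
structure IsLinearization {A : Type*} [NormedRing A] [NormedAlgebra ℂ A]
    (F : ℝ → ℂ → ℂ) (Γ : ℝ → ℂ → A) (b : A) (M : ℂ → A) : Prop where
  holomorphic : DifferentiableOn ℂ M (Metric.ball (0 : ℂ) 1)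
  isUnit : ∀ z ∈ Metric.ball (0 : ℂ) 1, IsUnit (M z)
  eq : ∀ t : ℝ, 0 ≤ t → ∀ z ∈ Metric.ball (0 : ℂ) 1,
    Γ t z = Ring.inverse (M (F t z)) * NormedSpace.exp ((t : ℂ) • b) * M z

/-!
A map `M` linearizes the semicocycle exactly when it has invertible values and is fixed by the
commuting operators `T_t h = exp (-t B₀) * h (F_t) * Γ_t`. At `z₀` the weight of `T_t` is
`exp (t ad B₀)`. Writing `h = h z₀ + (z - z₀) g` turns the fixed point equation of `T_t` into an
equation of the same kind for `g`, whose weight at `z₀` is multiplied by `F_t' z₀ = exp (-λ t)`.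
After finitely many such steps the weight at `z₀` has norm less than one and the equation is solved
by a Neumann series, since all orbits are attracted to `z₀`; a step with multiplier `exp (-k λ t)`
is solvable if `1 - exp (t (ad B₀ - k λ))` is invertible. By the spectral condition this holds for
all `k ≥ 1` at once if `t` is small, the large `k` being harmless. So for such a `t` there is a
unique fixed point of `T_t` with value `1` at `z₀`; by uniqueness every `T_s` preserves it, and its
invertibility spreads from a neighbourhood of `z₀` along backward orbits.
-/

open Filter Topology Set Metric

section Exponential

open NormedSpace

variable {𝔸 : Type*} [NormedRing 𝔸] [NormedAlgebra ℝ 𝔸] [CompleteSpace 𝔸]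

theorem exp_neg_mul_exp (x : 𝔸) : exp (-x) * exp x = 1 := by
  let := NormedAlgebra.restrictScalars ℚ ℝ 𝔸
  rw [← exp_add_of_commute (Commute.refl x).neg_left, neg_add_cancel, exp_zero]

theorem exp_mul_exp_neg (x : 𝔸) : exp x * exp (-x) = 1 := by
  simpa only [neg_neg] using exp_neg_mul_exp (-x)

theorem exp_add_smul (s t : ℝ) (x : 𝔸) : exp ((s + t) • x) = exp (s • x) * exp (t • x) := by
  let := NormedAlgebra.restrictScalars ℚ ℝ 𝔸
  rw [add_smul, exp_add_of_commute (((Commute.refl x).smul_left s).smul_right t)]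

theorem norm_exp_le [NormOneClass 𝔸] (x : 𝔸) : ‖exp x‖ ≤ Real.exp ‖x‖ := by
  rw [Real.exp_eq_exp_ℝ]
  refine (exp_series_hasSum_exp' (𝕂 := ℝ) x).norm_le_of_bounded
    (exp_series_hasSum_exp' (𝕂 := ℝ) ‖x‖) fun n => ?_
  rw [norm_smul, smul_eq_mul, Real.norm_of_nonneg (by positivity)]
  gcongr
  exact norm_pow_le x n

theorem eventually_isUnit_sub_of_hasDerivWithinAt {u : ℝ → 𝔸} {x : 𝔸} {a : ℝ}
    (hu : HasDerivWithinAt u x (Ici a) a) (hx : IsUnit x) :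
    ∀ᶠ t in 𝓝[>] a, IsUnit (u t - u a) := by
  rw [hasDerivWithinAt_iff_tendsto_slope, Ici_sdiff_left] at hu
  filter_upwards [hu.eventually (Units.isOpen.mem_nhds hx), self_mem_nhdsWithin] with t ht hat
  rw [← vsub_eq_sub, ← sub_smul_slope]
  exact (isUnit_smul_iff (Units.mk0 (t - a) (sub_pos.2 hat).ne') _).2 ht

theorem eventually_isUnit_one_sub_exp_smul {x : 𝔸} (hx : IsUnit x) :
    ∀ᶠ t : ℝ in 𝓝[>] 0, IsUnit (1 - exp (t • x)) := by
  have hderiv := hasDerivAt_exp_smul_const (𝕂 := ℝ) x 0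
  simp only [zero_smul, exp_zero, one_mul] at hderiv
  filter_upwards [eventually_isUnit_sub_of_hasDerivWithinAt hderiv.hasDerivWithinAt hx] with t ht
  rwa [zero_smul, exp_zero, IsUnit.sub_iff] at ht

end Exponential

section Nonresonance

open NormedSpace

variable {𝔸 : Type*} [NormedRing 𝔸] [NormedAlgebra ℂ 𝔸] [CompleteSpace 𝔸]

theorem exp_smul_sub_algebraMap (t : ℝ) (x : 𝔸) (c : ℂ) :
    exp (t • (x - algebraMap ℂ 𝔸 c)) = Complex.exp (-c * t) • exp (t • x) := by
  let := NormedAlgebra.restrictScalars ℚ ℝ 𝔸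
  have hcomm : Commute (t • x) (algebraMap ℂ 𝔸 (-c * t)) := Algebra.commute_algebraMap_right _ _
  have hsplit : t • (x - algebraMap ℂ 𝔸 c) = t • x + algebraMap ℂ 𝔸 (-c * t) := by
    rw [smul_sub, sub_eq_add_neg, neg_mul, map_neg, mul_comm c, map_mul, ← Algebra.smul_def,
      Complex.coe_smul]
  rw [hsplit, exp_add_of_commute hcomm, ← algebraMap_exp_comm, ← Complex.exp_eq_exp_ℂ,
    ← Algebra.commutes, ← Algebra.smul_def]

theorem exists_forall_isUnit_one_sub_exp_smul [NormOneClass 𝔸] {x : 𝔸} {c : ℂ} (hc : 0 < c.re)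
    (hx : ∀ k : ℕ, 1 ≤ k → c * k ∉ spectrum ℂ x) :
    ∃ t : ℝ, 0 < t ∧
      ∀ k : ℕ, 1 ≤ k → IsUnit (1 - Complex.exp (-c * t) ^ k • exp (t • x)) := by
  have hexp (t : ℝ) (k : ℕ) : Complex.exp (-c * t) ^ k • exp (t • x) =
      exp (t • (x - algebraMap ℂ 𝔸 (c * k))) := by
    rw [exp_smul_sub_algebraMap, ← Complex.exp_nat_mul]
    ring_nf
  have hsmall : ∀ᶠ t : ℝ in 𝓝[>] 0, ∀ k ∈ Finset.Icc 1 ⌊‖x‖ / c.re⌋₊,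
      IsUnit (1 - exp (t • (x - algebraMap ℂ 𝔸 (c * k)))) := by
    rw [Finset.eventually_all]
    intro k hk
    have hunit : IsUnit (x - algebraMap ℂ 𝔸 (c * k)) := by
      simpa using (spectrum.notMem_iff.1 (hx k (Finset.mem_Icc.1 hk).1)).neg
    exact eventually_isUnit_one_sub_exp_smul hunit
  obtain ⟨t, ht, ht0⟩ := (hsmall.and self_mem_nhdsWithin).exists
  have ht0 : 0 < t := ht0
  refine ⟨t, ht0, fun k hk => ?_⟩
  rcases le_or_gt k ⌊‖x‖ / c.re⌋₊ with hle | hgt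
  · rw [hexp]
    exact ht k (Finset.mem_Icc.2 ⟨hk, hle⟩)
  · refine isUnit_one_sub_of_norm_lt_one ?_
    have hk' : ‖x‖ < k * c.re := (div_lt_iff₀ hc).1 ((Nat.floor_lt (by positivity)).1 hgt)
    calc ‖Complex.exp (-c * t) ^ k • exp (t • x)‖
        ≤ Real.exp (-c.re * t) ^ k * Real.exp (t * ‖x‖) := by
          rw [norm_smul, norm_pow, Complex.norm_exp, Complex.re_mul_ofReal, Complex.neg_re]
          refine mul_le_mul_of_nonneg_left ((norm_exp_le _).trans ?_) (by positivity)
          rw [norm_smul, Real.norm_of_nonneg ht0.le]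
      _ = Real.exp (t * (‖x‖ - k * c.re)) := by
          rw [← Real.exp_nat_mul, ← Real.exp_add]
          ring_nf
      _ < 1 := Real.exp_lt_one_iff.2 (mul_neg_of_pos_of_neg ht0 (sub_neg.2 hk'))

end Nonresonance

section RightDerivative

variable {E : Type*} [NormedAddCommGroup E] [NormedSpace ℝ E] {u : ℝ → E} {t : ℝ}

theorem hasDerivWithinAt_Ici_of_shift {v : E}
    (h : HasDerivWithinAt (fun s => u (s + t)) v (Ici 0) 0) : HasDerivWithinAt u v (Ici t) t := by
  have hshift : HasDerivWithinAt (fun s => u (s + t)) v (Ici 0) (t - t) := by simpa using h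
  have hsub : HasDerivWithinAt (fun s : ℝ => s - t) 1 (Ici t) t :=
    (hasDerivWithinAt_id t (Ici t)).sub_const t
  simpa [Function.comp_def] using
    hshift.scomp (h := fun s => s - t) t hsub fun s hs => mem_Ici.2 (sub_nonneg.2 hs)

theorem hasDerivWithinAt_integral_Ici [CompleteSpace E] (hu : ContinuousOn u (Ici 0))
    (ht : 0 ≤ t) : HasDerivWithinAt (fun b => ∫ x in 0..b, u x) (u t) (Ici t) t := by
  have hsub : Ici t ⊆ Ici 0 := Ici_subset_Ici.2 ht
  have hint : IntervalIntegrable u MeasureTheory.volume 0 t :=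
    (hu.mono (uIcc_of_le ht ▸ Icc_subset_Ici_self)).intervalIntegrable
  have hmeas : StronglyMeasurableAtFilter u (𝓝[>] t) :=
    ⟨Ici 0, mem_of_superset self_mem_nhdsWithin (Ioi_subset_Ici_self.trans hsub),
      hu.aestronglyMeasurable measurableSet_Ici⟩
  exact intervalIntegral.integral_hasDerivWithinAt_right hint hmeas
    ((hu t ht).mono (Ioi_subset_Ici_self.trans hsub))

end RightDerivative

section NormContinuousSemigroup

open NormedSpace

variable {𝔸 : Type*} [NormedRing 𝔸]

/-- A norm-continuous one-parameter semigroup in a normed ring. As `S` is defined on all of `ℝ`,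
nothing is required of its values at negative times. -/
structure IsNormContinuousSemigroup (S : ℝ → 𝔸) : Prop where
  continuousOn : ContinuousOn S (Ici 0)
  zero : S 0 = 1
  add : ∀ s t, 0 ≤ s → 0 ≤ t → S (s + t) = S s * S t

namespace IsNormContinuousSemigroup

variable {S : ℝ → 𝔸}

theorem intervalIntegrable (hS : IsNormContinuousSemigroup S) {a b : ℝ} (ha : 0 ≤ a)
    (hb : 0 ≤ b) : IntervalIntegrable S MeasureTheory.volume a b :=
  (hS.continuousOn.mono (ordConnected_Ici.uIcc_subset ha hb)).intervalIntegrable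

variable [NormedAlgebra ℝ 𝔸] [CompleteSpace 𝔸]

theorem integral_mul_apply (hS : IsNormContinuousSemigroup S) {a t : ℝ} (ha : 0 ≤ a)
    (ht : 0 ≤ t) :
    (∫ x in 0..a, S x) * S t = (∫ x in 0..(t + a), S x) - ∫ x in 0..t, S x := by
  calc (∫ x in 0..a, S x) * S t = ∫ x in 0..a, S x * S t :=
        (((ContinuousLinearMap.mul ℝ 𝔸).flip (S t)).intervalIntegral_comp_comm
          (hS.intervalIntegrable le_rfl ha)).symm
    _ = ∫ x in 0..a, S (t + x) := by
        refine intervalIntegral.integral_congr fun x hx => ?_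
        rw [uIcc_of_le ha] at hx
        rw [add_comm, hS.add x t hx.1 ht]
    _ = ∫ x in t..(t + a), S x := by
        rw [intervalIntegral.integral_comp_add_left, add_zero]
    _ = _ := (intervalIntegral.integral_interval_sub_left
        (hS.intervalIntegrable le_rfl (add_nonneg ht ha)) (hS.intervalIntegrable le_rfl ht)).symm

theorem exists_isUnit_integral (hS : IsNormContinuousSemigroup S) :
    ∃ a : ℝ, 0 < a ∧ IsUnit (∫ x in 0..a, S x) := by
  have hderiv := hasDerivWithinAt_integral_Ici hS.continuousOn le_rfl
  have hunit := eventually_isUnit_sub_of_hasDerivWithinAt hderiv (hS.zero ▸ isUnit_one)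
  obtain ⟨a, ha, ha0⟩ := (hunit.and self_mem_nhdsWithin).exists
  exact ⟨a, ha0, by simpa using ha⟩

theorem differentiableWithinAt_zero (hS : IsNormContinuousSemigroup S) :
    DifferentiableWithinAt ℝ S (Ici 0) 0 := by
  obtain ⟨a, ha, hunit⟩ := hS.exists_isUnit_integral
  have hquot : ∀ t ∈ Ici (0 : ℝ), S t =
      Ring.inverse (∫ x in 0..a, S x) * ((∫ x in 0..(t + a), S x) - ∫ x in 0..t, S x) :=
    fun t ht => by
      rw [← hS.integral_mul_apply ha.le ht, Ring.inverse_mul_cancel_left _ _ hunit]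
  refine DifferentiableWithinAt.congr ?_ hquot (hquot 0 self_mem_Ici)
  have hend : DifferentiableWithinAt ℝ (fun b => ∫ x in 0..b, S x) (Ici a) (0 + a) := by
    rw [zero_add]
    exact (hasDerivWithinAt_integral_Ici hS.continuousOn ha.le).differentiableWithinAt
  have hshift : DifferentiableWithinAt ℝ (fun t => ∫ x in 0..(t + a), S x) (Ici 0) 0 :=
    hend.comp (f := (· + a)) 0 (by fun_prop) fun t ht => by simpa using ht
  exact (hshift.sub (hasDerivWithinAt_integral_Ici hS.continuousOn
    le_rfl).differentiableWithinAt).const_mul _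

theorem eq_exp (hS : IsNormContinuousSemigroup S) {b : 𝔸}
    (hb : HasDerivWithinAt S b (Ici 0) 0) {t : ℝ} (ht : 0 ≤ t) : S t = exp (t • b) := by
  have hSderiv (x : ℝ) (hx : 0 ≤ x) : HasDerivWithinAt S (b * S x) (Ici x) x :=
    hasDerivWithinAt_Ici_of_shift <|
      (hb.mul_const (S x)).congr (fun s hs => hS.add s x hs hx) (by rw [hS.add 0 x le_rfl hx])
  have hexp (x : ℝ) : HasDerivAt (fun u : ℝ => exp (u • -b)) (exp (x • -b) * -b) x :=
    hasDerivAt_exp_smul_const (-b) x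
  have hconst : exp (t • -b) * S t = exp ((0 : ℝ) • -b) * S 0 :=
    constant_of_has_deriv_right_zero (f := fun u => exp (u • -b) * S u)
      (ContinuousOn.mul (fun x _ => (hexp x).continuousAt.continuousWithinAt)
        (hS.continuousOn.mono Icc_subset_Ici_self))
      (fun x hx => ((hexp x).hasDerivWithinAt.mul (hSderiv x hx.1)).congr_deriv <| by
        simp only [mul_neg, neg_mul, mul_assoc, neg_add_cancel])
      t ⟨ht, le_rfl⟩
  rw [zero_smul, exp_zero, hS.zero, one_mul, smul_neg] at hconst
  rw [← one_mul (S t), ← exp_mul_exp_neg (t • b), mul_assoc, hconst, mul_one]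

end IsNormContinuousSemigroup

variable {A : Type*} [NormedRing A] [NormedAlgebra ℂ A]

theorem adOp_smul (t : ℝ) (b : A) : adOp (t • b) = t • adOp b := by
  ext x
  simp [adOp_apply, smul_sub]

open ContinuousLinearMap (mul)

variable [CompleteSpace A]

theorem hasDerivAt_mul_exp_smul (b : A) : HasDerivAt
    (fun t : ℝ => mul ℂ A (exp (t • -b)) * (mul ℂ A).flip (exp (t • b))) (adOp b) 0 := by
  have hexp (c : A) : HasDerivAt (fun t : ℝ => exp (t • c)) c 0 := by
    simpa using hasDerivAt_exp_smul_const (𝕂 := ℝ) c 0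
  have hleft := ((mul ℂ A).restrictScalars ℝ).hasFDerivAt.comp_hasDerivAt 0 (hexp (-b))
  have hright := ((mul ℂ A).flip.restrictScalars ℝ).hasFDerivAt.comp_hasDerivAt 0 (hexp b)
  refine (hleft.mul hright).congr_deriv ?_
  ext x
  simp [adOp_apply, sub_eq_neg_add]

theorem exp_adOp_apply (b x : A) : exp (adOp b) x = exp (-b) * x * exp b := by
  have hsemigroup : IsNormContinuousSemigroup
      (fun t : ℝ => mul ℂ A (exp (t • -b)) * (mul ℂ A).flip (exp (t • b))) :=
    { continuousOn := by
        have hexp (c : A) : Continuous fun t : ℝ => exp (t • c) :=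
          continuous_iff_continuousAt.2 fun t =>
            (hasDerivAt_exp_smul_const (𝕂 := ℝ) c t).continuousAt
        exact (((mul ℂ A).continuous.comp (hexp (-b))).mul
          ((mul ℂ A).flip.continuous.comp (hexp b))).continuousOn
      zero := by
        ext x
        simp
      add := fun s t _ _ => by
        ext x
        have hright : exp ((s + t) • b) = exp (t • b) * exp (s • b) := by
          rw [add_comm, exp_add_smul]
        simp only [exp_add_smul s t (-b), hright]
        simp [mul_assoc] }
  rw [← one_smul ℝ (adOp b),
    ← hsemigroup.eq_exp (hasDerivAt_mul_exp_smul b).hasDerivWithinAt zero_le_one]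
  simp [mul_assoc]

end NormContinuousSemigroup

section AttractingSelfMap

theorem eventually_norm_sub_le_mul_of_norm_deriv_lt {E : Type*} [NormedAddCommGroup E]
    [NormedSpace ℂ E] {f : ℂ → E} {z₀ : ℂ} {q : ℝ} (hf : DifferentiableAt ℂ f z₀)
    (hq : ‖deriv f z₀‖ < q) : ∀ᶠ z in 𝓝 z₀, ‖f z - f z₀‖ ≤ q * ‖z - z₀‖ := by
  have hcont : ContinuousAt (fun z => ‖dslope f z₀ z‖) z₀ := (continuousAt_dslope_same.2 hf).norm
  filter_upwards [hcont.eventually_lt_const (by simpa using hq)] with z hz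
  rw [← sub_smul_dslope, norm_smul, mul_comm]
  gcongr

variable {φ : ℂ → ℂ} {U : Set ℂ} {z₀ : ℂ}

theorem exists_ball_subset_mapsTo_ball (hφ : DifferentiableAt ℂ φ z₀) (hfix : φ z₀ = z₀)
    (hderiv : ‖deriv φ z₀‖ < 1) {V : Set ℂ} (hV : V ∈ 𝓝 z₀) :
    ∃ r > 0, ball z₀ r ⊆ V ∧ MapsTo φ (ball z₀ r) (ball z₀ r) := by
  obtain ⟨q, hq, hq1⟩ := exists_between hderiv
  have hcontract := eventually_norm_sub_le_mul_of_norm_deriv_lt hφ hq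
  obtain ⟨r, hr, hball⟩ := Metric.mem_nhds_iff.1 (inter_mem hV hcontract)
  refine ⟨r, hr, fun z hz => (hball hz).1, fun z hz => ?_⟩
  have hz' : ‖φ z - φ z₀‖ ≤ q * ‖z - z₀‖ := (hball hz).2
  rw [hfix] at hz'
  rw [mem_ball_iff_norm] at hz ⊢
  exact (hz'.trans (mul_le_of_le_one_left (norm_nonneg _) hq1.le)).trans_lt hz

theorem eventually_tendsto_iterate_of_norm_deriv_lt_one (hφ : DifferentiableAt ℂ φ z₀)
    (hfix : φ z₀ = z₀) (hderiv : ‖deriv φ z₀‖ < 1) :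
    ∀ᶠ z in 𝓝 z₀, Tendsto (fun n => φ^[n] z) atTop (𝓝 z₀) := by
  obtain ⟨q, hq, hq1⟩ := exists_between hderiv
  have hq0 : 0 ≤ q := (norm_nonneg _).trans hq.le
  obtain ⟨r, hr, hball, hmaps⟩ := exists_ball_subset_mapsTo_ball hφ hfix hderiv
    (eventually_norm_sub_le_mul_of_norm_deriv_lt hφ hq)
  filter_upwards [ball_mem_nhds z₀ hr] with z hz
  have hgeom (n : ℕ) : ‖φ^[n] z - z₀‖ ≤ ‖z - z₀‖ * q ^ n := by
    induction n with
    | zero => simp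
    | succ n ih =>
      have hstep : ‖φ (φ^[n] z) - φ z₀‖ ≤ q * ‖φ^[n] z - z₀‖ := hball (hmaps.iterate n hz)
      rw [Function.iterate_succ_apply', pow_succ', mul_left_comm]
      rw [hfix] at hstep
      exact hstep.trans (mul_le_mul_of_nonneg_left ih hq0)
  refine tendsto_iff_norm_sub_tendsto_zero.2 (squeeze_zero (fun _ => norm_nonneg _) hgeom ?_)
  simpa using (tendsto_pow_atTop_nhds_zero_of_lt_one hq0 hq1).const_mul ‖z - z₀‖

theorem tendsto_iterate_of_tendsto_iterate_apply {z : ℂ} {m : ℕ}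
    (h : Tendsto (fun n => φ^[n] (φ^[m] z)) atTop (𝓝 z₀)) :
    Tendsto (fun n => φ^[n] z) atTop (𝓝 z₀) := by
  simpa only [← Function.iterate_add_apply,
    tendsto_add_atTop_iff_nat (f := fun n => φ^[n] z)] using h

/-- The Lipschitz constant given by the Schwarz lemma depends on `φ^[n]` only through a bound on its
range, hence not on `n`. -/
theorem exists_dist_iterate_le_mul_dist (hUo : IsOpen U) (hUb : Bornology.IsBounded U)
    (hφ : DifferentiableOn ℂ φ U) (hmaps : MapsTo φ U U) {z : ℂ} (hz : z ∈ U) :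
    ∃ K : ℝ, ∀ᶠ w in 𝓝 z, ∀ n, dist (φ^[n] w) (φ^[n] z) ≤ K * dist w z := by
  obtain ⟨r, hr, hball⟩ := Metric.isOpen_iff.1 hUo z hz
  refine ⟨diam U / r, ?_⟩
  filter_upwards [ball_mem_nhds z hr] with w hw n
  exact Complex.dist_le_div_mul_dist_of_mapsTo_ball ((hφ.iterate hmaps n).mono hball)
    (fun v hv => mem_closedBall.2 <|
      dist_le_diam_of_mem hUb (hmaps.iterate n (hball hv)) (hmaps.iterate n hz)) hw

theorem tendsto_iterate_of_norm_deriv_lt_one (hUo : IsOpen U) (hUc : IsPreconnected U)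
    (hUb : Bornology.IsBounded U) (hφ : DifferentiableOn ℂ φ U) (hmaps : MapsTo φ U U)
    (hz₀ : z₀ ∈ U) (hfix : φ z₀ = z₀) (hderiv : ‖deriv φ z₀‖ < 1) {z : ℂ} (hz : z ∈ U) :
    Tendsto (fun n => φ^[n] z) atTop (𝓝 z₀) := by
  set basin : Set ℂ := {w | Tendsto (fun n => φ^[n] w) atTop (𝓝 z₀)}
  have hφ₀ := hφ.differentiableAt (hUo.mem_nhds hz₀)
  have hlocal : basin ∈ 𝓝 z₀ := eventually_tendsto_iterate_of_norm_deriv_lt_one hφ₀ hfix hderiv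
  have hopen : IsOpen (U ∩ basin) := by
    refine isOpen_iff_mem_nhds.2 fun w hw => ?_
    obtain ⟨m, hm⟩ := (hw.2.eventually (eventually_mem_nhds_iff.2 hlocal)).exists
    have hcont : ContinuousAt φ^[m] w :=
      ((hφ.iterate hmaps m).differentiableAt (hUo.mem_nhds hw.1)).continuousAt
    filter_upwards [hUo.mem_nhds hw.1, hcont hm] with v hvU hv
    exact ⟨hvU, tendsto_iterate_of_tendsto_iterate_apply hv⟩
  have hclosed : closure (U ∩ basin) ∩ U ⊆ U ∩ basin := by
    rintro w ⟨hwc, hwU⟩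
    obtain ⟨K, hK⟩ := exists_dist_iterate_le_mul_dist hUo hUb hφ hmaps hwU
    obtain ⟨ε, hε, hball⟩ := Metric.mem_nhds_iff.1 hlocal
    have hsmall : ∀ᶠ v in 𝓝 w, K * dist v w < ε / 2 := by
      have hcont : Tendsto (fun v => K * dist v w) (𝓝 w) (𝓝 (K * dist w w)) :=
        Continuous.tendsto (by fun_prop) w
      exact hcont.eventually_lt_const (by simpa using hε)
    obtain ⟨v, hv, hvK, hvε⟩ := (mem_closure_iff_frequently.1 hwc).and_eventually (hK.and hsmall)
      |>.exists
    obtain ⟨m, hm⟩ := (hv.2.eventually (ball_mem_nhds z₀ (half_pos hε))).exists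
    refine ⟨hwU, tendsto_iterate_of_tendsto_iterate_apply (m := m) (hball (mem_ball.2 ?_))⟩
    calc dist (φ^[m] w) z₀
        ≤ dist (φ^[m] v) (φ^[m] w) + dist (φ^[m] v) z₀ := dist_triangle_left _ _ _
      _ < ε / 2 + ε / 2 := add_lt_add ((hvK m).trans_lt hvε) hm
      _ = ε := add_halves ε
  exact (hUc.subset_of_closure_inter_subset hopen
    ⟨z₀, hz₀, hz₀, mem_of_mem_nhds hlocal⟩ hclosed hz).2

/-- `φ` is a holomorphic self-map of the open set `U` all of whose orbits converge to the fixed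
point `z₀`, at which `φ` has a multiplier of modulus less than one. -/
structure IsAttractingSelfMap (φ : ℂ → ℂ) (U : Set ℂ) (z₀ : ℂ) : Prop where
  isOpen : IsOpen U
  mem : z₀ ∈ U
  mapsTo : MapsTo φ U U
  holomorphic : DifferentiableOn ℂ φ U
  fixed : φ z₀ = z₀
  norm_deriv_lt_one : ‖deriv φ z₀‖ < 1
  tendsto_iterate : ∀ z ∈ U, Tendsto (fun n => φ^[n] z) atTop (𝓝 z₀)

namespace IsAttractingSelfMap

theorem of_isBounded (hUo : IsOpen U) (hUc : IsPreconnected U)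
    (hUb : Bornology.IsBounded U) (hφ : DifferentiableOn ℂ φ U) (hmaps : MapsTo φ U U)
    (hz₀ : z₀ ∈ U) (hfix : φ z₀ = z₀) (hderiv : ‖deriv φ z₀‖ < 1) :
    IsAttractingSelfMap φ U z₀ :=
  ⟨hUo, hz₀, hmaps, hφ, hfix, hderiv, fun _ =>
    tendsto_iterate_of_norm_deriv_lt_one hUo hUc hUb hφ hmaps hz₀ hfix hderiv⟩

variable (hφ : IsAttractingSelfMap φ U z₀)

include hφ

theorem mem_nhds : U ∈ 𝓝 z₀ :=
  hφ.isOpen.mem_nhds hφ.mem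

theorem exists_ball {V : Set ℂ} (hV : V ∈ 𝓝 z₀) :
    ∃ r > 0, ball z₀ r ⊆ V ∧ MapsTo φ (ball z₀ r) (ball z₀ r) :=
  exists_ball_subset_mapsTo_ball (hφ.holomorphic.differentiableAt hφ.mem_nhds) hφ.fixed
    hφ.norm_deriv_lt_one hV

theorem continuousAt {z : ℂ} (hz : z ∈ U) : ContinuousAt φ z :=
  (hφ.holomorphic.differentiableAt (hφ.isOpen.mem_nhds hz)).continuousAt

theorem backward_induction {P : ℂ → Prop} (hnear : ∀ᶠ z in 𝓝 z₀, P z)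
    (hstep : ∀ z ∈ U, P (φ z) → P z) {z : ℂ} (hz : z ∈ U) : P z := by
  obtain ⟨n, hn⟩ := ((hφ.tendsto_iterate z hz).eventually hnear).exists
  induction n generalizing z with
  | zero => exact hn
  | succ n ih => exact hstep z hz (ih (hφ.mapsTo hz) hn)

end IsAttractingSelfMap

end AttractingSelfMap

section WeightedComposition

variable {E : Type*} [NormedAddCommGroup E] [NormedSpace ℂ E] {L : ℂ → E →L[ℂ] E} {φ : ℂ → ℂ}
  {U : Set ℂ} {z₀ : ℂ}

/-- The weighted composition operator `h ↦ L · (h ∘ φ)` with operator-valued weight `L`. -/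
def weightedComp (L : ℂ → E →L[ℂ] E) (φ : ℂ → ℂ) (h : ℂ → E) (z : ℂ) : E :=
  L z (h (φ z))

theorem differentiableOn_weightedComp (hL : DifferentiableOn ℂ L U)
    (hφ : DifferentiableOn ℂ φ U) (hmaps : MapsTo φ U U) {h : ℂ → E}
    (hh : DifferentiableOn ℂ h U) : DifferentiableOn ℂ (weightedComp L φ h) U :=
  hL.clm_apply (hh.comp hφ hmaps)

theorem differentiableOn_iterate_weightedComp (hL : DifferentiableOn ℂ L U)
    (hφ : DifferentiableOn ℂ φ U) (hmaps : MapsTo φ U U) {h : ℂ → E}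
    (hh : DifferentiableOn ℂ h U) (n : ℕ) :
    DifferentiableOn ℂ ((weightedComp L φ)^[n] h) U := by
  induction n with
  | zero => exact hh
  | succ n ih =>
    rw [Function.iterate_succ_apply']
    exact differentiableOn_weightedComp hL hφ hmaps ih

theorem norm_iterate_weightedComp_le {B : Set ℂ} {ρ C : ℝ} {w : ℂ → E} (hρ : 0 ≤ ρ)
    (hmaps : MapsTo φ B B) (hL : ∀ z ∈ B, ‖L z‖ ≤ ρ) (hw : ∀ z ∈ B, ‖w z‖ ≤ C) {z : ℂ}
    (hz : z ∈ B) (n : ℕ) : ‖(weightedComp L φ)^[n] w z‖ ≤ C * ρ ^ n := by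
  induction n generalizing z with
  | zero => simpa using hw z hz
  | succ n ih =>
    rw [Function.iterate_succ_apply', pow_succ', mul_left_comm]
    exact ((L z).le_of_opNorm_le (hL z hz) _).trans
      (mul_le_mul_of_nonneg_left (ih (hmaps hz)) hρ)

theorem eventually_norm_le_norm_add_one {X G : Type*} [TopologicalSpace X]
    [SeminormedAddCommGroup G] {u : X → G} {x : X} (hu : ContinuousAt u x) :
    ∀ᶠ y in 𝓝 x, ‖u y‖ ≤ ‖u x‖ + 1 :=
  (hu.norm.eventually_lt_const (lt_add_one _)).mono fun _ => le_of_lt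

theorem IsAttractingSelfMap.exists_norm_iterate_weightedComp_le
    (hφ : IsAttractingSelfMap φ U z₀) (hL : ContinuousOn L U) {ρ : ℝ} (hρ : ‖L z₀‖ < ρ)
    {w : ℂ → E} (hw : ContinuousOn w U) {z : ℂ} (hz : z ∈ U) :
    ∃ C : ℝ, ∀ᶠ z' in 𝓝 z, ∀ n, ‖(weightedComp L φ)^[n] w z'‖ ≤ C * ρ ^ n := by
  have hρ0 : 0 < ρ := (norm_nonneg _).trans_lt hρ
  refine hφ.backward_induction (P := fun z => ∃ C : ℝ, ∀ᶠ z' in 𝓝 z, ∀ n,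
    ‖(weightedComp L φ)^[n] w z'‖ ≤ C * ρ ^ n) ?_ (fun z hz => ?_) hz
  · have hLρ := (hL.continuousAt hφ.mem_nhds).norm.eventually_lt_const hρ
    have hwC := eventually_norm_le_norm_add_one (hw.continuousAt hφ.mem_nhds)
    obtain ⟨r, hr, hball, hmaps⟩ := hφ.exists_ball (hLρ.and hwC)
    filter_upwards [ball_mem_nhds z₀ hr] with z hz
    refine ⟨‖w z₀‖ + 1, ?_⟩
    filter_upwards [isOpen_ball.mem_nhds hz] with z' hz' n
    exact norm_iterate_weightedComp_le hρ0.le hmaps (fun v hv => (hball hv).1.le)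
      (fun v hv => (hball hv).2) hz' n
  · rintro ⟨C, hC⟩
    have hUz : U ∈ 𝓝 z := hφ.isOpen.mem_nhds hz
    refine ⟨max (‖w z‖ + 1) ((‖L z‖ + 1) * C / ρ), ?_⟩
    filter_upwards [(hφ.continuousAt hz).eventually hC,
      eventually_norm_le_norm_add_one (hL.continuousAt hUz),
      eventually_norm_le_norm_add_one (hw.continuousAt hUz)] with z' hCz' hLz' hwz' n
    cases n with
    | zero => simpa using Or.inl hwz'
    | succ n =>
      rw [Function.iterate_succ_apply']
      calc ‖weightedComp L φ ((weightedComp L φ)^[n] w) z'‖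
          ≤ ‖L z'‖ * ‖(weightedComp L φ)^[n] w (φ z')‖ := (L z').le_opNorm _
        _ ≤ (‖L z‖ + 1) * (C * ρ ^ n) := by
            gcongr
            exact hCz' n
        _ = (‖L z‖ + 1) * C / ρ * ρ ^ (n + 1) := by
            field_simp
            ring
        _ ≤ _ := by
            gcongr
            exact le_max_right _ _

theorem IsAttractingSelfMap.exists_eq_add_weightedComp_of_norm_lt_one [CompleteSpace E]
    (hφ : IsAttractingSelfMap φ U z₀) (hL : DifferentiableOn ℂ L U) (hL₁ : ‖L z₀‖ < 1)
    {w : ℂ → E} (hw : DifferentiableOn ℂ w U) :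
    ∃ g, DifferentiableOn ℂ g U ∧ ∀ z ∈ U, g z = w z + weightedComp L φ g z := by
  obtain ⟨ρ, hρ, hρ₁⟩ := exists_between hL₁
  have hgeom (C : ℝ) : Summable fun n : ℕ => C * ρ ^ n :=
    (summable_geometric_of_lt_one ((norm_nonneg _).trans hρ.le) hρ₁).mul_left C
  have hbound (z : ℂ) (hz : z ∈ U) :=
    hφ.exists_norm_iterate_weightedComp_le hL.continuousOn hρ hw.continuousOn hz
  have hsum (z : ℂ) (hz : z ∈ U) : Summable fun n => (weightedComp L φ)^[n] w z := by
    obtain ⟨C, hC⟩ := hbound z hz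
    exact (hgeom C).of_norm_bounded hC.self_of_nhds
  refine ⟨fun z => ∑' n, (weightedComp L φ)^[n] w z, fun z hz => ?_, fun z hz => ?_⟩
  · obtain ⟨C, hC⟩ := hbound z hz
    obtain ⟨V, hV, hVo, hzV⟩ := _root_.eventually_nhds_iff.1 (hC.and (hφ.isOpen.mem_nhds hz))
    have hdiff : DifferentiableOn ℂ (fun z => ∑' n, (weightedComp L φ)^[n] w z) V :=
      Complex.differentiableOn_tsum_of_summable_norm (hgeom C)
        (fun n => (differentiableOn_iterate_weightedComp hL hφ.holomorphic hφ.mapsTo hw n).mono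
          fun v hv => (hV v hv).2)
        hVo fun n v hv => (hV v hv).1 n
    exact (hdiff.differentiableAt (hVo.mem_nhds hzV)).differentiableWithinAt
  · beta_reduce
    rw [(hsum z hz).tsum_eq_zero_add, weightedComp, (L z).map_tsum (hsum _ (hφ.mapsTo hz))]
    simp only [Function.iterate_succ_apply', weightedComp, Function.iterate_zero, id]

theorem IsAttractingSelfMap.eq_zero_of_eq_weightedComp_of_norm_lt_one
    (hφ : IsAttractingSelfMap φ U z₀) (hL : ContinuousOn L U) (hL₁ : ‖L z₀‖ < 1) {h : ℂ → E}
    (hh : ContinuousOn h U) (heq : ∀ z ∈ U, h z = weightedComp L φ h z) {z : ℂ} (hz : z ∈ U) :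
    h z = 0 := by
  obtain ⟨ρ, hρ, hρ₁⟩ := exists_between hL₁
  obtain ⟨C, hC⟩ := hφ.exists_norm_iterate_weightedComp_le hL hρ hh hz
  have hiter (n : ℕ) : ∀ v ∈ U, (weightedComp L φ)^[n] h v = h v := by
    induction n with
    | zero => exact fun v _ => rfl
    | succ n ih =>
      intro v hv
      rw [Function.iterate_succ_apply', weightedComp, ih _ (hφ.mapsTo hv), heq v hv, weightedComp]
  have hlim : Tendsto (fun n : ℕ => C * ρ ^ n) atTop (𝓝 0) := by
    simpa using (tendsto_pow_atTop_nhds_zero_of_lt_one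
      ((norm_nonneg _).trans hρ.le) hρ₁).const_mul C
  refine norm_le_zero_iff.1 (ge_of_tendsto' hlim fun n => ?_)
  simpa only [hiter n z hz] using hC.self_of_nhds n

theorem sub_mul_dslope_of_fixed (hφ : φ z₀ = z₀) (z : ℂ) :
    (z - z₀) * dslope φ z₀ z = φ z - z₀ := by
  simpa only [hφ, smul_eq_mul] using sub_smul_dslope φ z₀ z

theorem eq_add_weightedComp_of_dslope {w g : ℂ → E} {c : E} {z : ℂ} (hφ : φ z₀ = z₀)
    (hc : w z₀ + L z₀ c = c)
    (hg : g z = dslope (fun x => w x + L x c) z₀ z +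
      weightedComp (dslope φ z₀ • L) φ g z) :
    c + (z - z₀) • g z = w z + weightedComp L φ (fun x => c + (x - z₀) • g x) z := by
  have hw := sub_smul_dslope (fun x => w x + L x c) z₀ z
  rw [hg, smul_add, hw, hc]
  simp only [weightedComp, Pi.smul_apply', smul_apply, smul_smul,
    sub_mul_dslope_of_fixed hφ, map_add, map_smul]
  abel

theorem IsAttractingSelfMap.dslope_eq_weightedComp (hφ : IsAttractingSelfMap φ U z₀)
    (hL : ContinuousOn L U) {h : ℂ → E} (hh : DifferentiableOn ℂ h U) (h₀ : h z₀ = 0)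
    (heq : ∀ z ∈ U, h z = weightedComp L φ h z) :
    ∀ z ∈ U, dslope h z₀ z = weightedComp (dslope φ z₀ • L) φ (dslope h z₀) z := by
  have hdh : ContinuousAt (dslope h z₀) z₀ :=
    continuousAt_dslope_same.2 (hh.differentiableAt hφ.mem_nhds)
  have hdφ : ContinuousAt (dslope φ z₀) z₀ :=
    continuousAt_dslope_same.2 (hφ.holomorphic.differentiableAt hφ.mem_nhds)
  have hoff (z : ℂ) (hz : z ∈ U) (hne : z ≠ z₀) :
      dslope h z₀ z = weightedComp (dslope φ z₀ • L) φ (dslope h z₀) z := by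
    have hval (v : ℂ) : (v - z₀) • dslope h z₀ v = h v := by
      rw [sub_smul_dslope, h₀, sub_zero]
    refine smul_right_injective E (sub_ne_zero.2 hne) ?_
    simp only [weightedComp, Pi.smul_apply', smul_apply, smul_smul,
      sub_mul_dslope_of_fixed hφ.fixed]
    rw [hval, ← map_smul, hval, heq z hz, weightedComp]
  have hcont : ContinuousAt
      (weightedComp (dslope φ z₀ • L) φ (dslope h z₀)) z₀ :=
    (hdφ.smul (hL.continuousAt hφ.mem_nhds)).clm_apply
      (ContinuousAt.comp (by rwa [hφ.fixed]) (hφ.continuousAt hφ.mem))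
  have hnear : dslope h z₀ =ᶠ[𝓝[≠] z₀]
      weightedComp (dslope φ z₀ • L) φ (dslope h z₀) := by
    filter_upwards [mem_nhdsWithin_of_mem_nhds hφ.mem_nhds, self_mem_nhdsWithin] with z hz hne
    exact hoff z hz hne
  intro z hz
  rcases eq_or_ne z z₀ with rfl | hne
  · exact ((hdh.eventuallyEq_nhds_iff_eventuallyEq_nhdsNE hcont).1 hnear).self_of_nhds
  · exact hoff z hz hne

theorem IsAttractingSelfMap.differentiableOn_dslope_smul (hφ : IsAttractingSelfMap φ U z₀)
    (hL : DifferentiableOn ℂ L U) : DifferentiableOn ℂ (dslope φ z₀ • L) U :=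
  ((Complex.differentiableOn_dslope hφ.mem_nhds).2 hφ.holomorphic).smul hL

theorem eq_zero_of_dslope_eq_zero {h : ℂ → E} {z : ℂ} (h₀ : h z₀ = 0) (hz : dslope h z₀ z = 0) :
    h z = 0 := by
  simpa [h₀, hz] using (sub_smul_dslope h z₀ z).symm

theorem pow_deriv_smul_dslope_smul_apply (k : ℕ) :
    deriv φ z₀ ^ k • (dslope φ z₀ • L) z₀ = deriv φ z₀ ^ (k + 1) • L z₀ := by
  rw [Pi.smul_apply', dslope_same, smul_smul, pow_succ]

theorem IsAttractingSelfMap.exists_norm_pow_smul_lt_one {G : Type*} [NormedAddCommGroup G]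
    [NormedSpace ℂ G] (hφ : IsAttractingSelfMap φ U z₀) (x : G) :
    ∃ n : ℕ, ‖deriv φ z₀ ^ n • x‖ < 1 := by
  have hlim : Tendsto (fun n : ℕ => ‖deriv φ z₀ ^ n • x‖) atTop (𝓝 0) := by
    simpa using ((tendsto_pow_atTop_nhds_zero_of_norm_lt_one
      hφ.norm_deriv_lt_one).smul_const x).norm
  exact (hlim.eventually_lt_const one_pos).exists

variable [CompleteSpace E]

theorem IsAttractingSelfMap.eq_zero_of_eq_weightedComp_of_norm_pow_smul_lt_one
    (hφ : IsAttractingSelfMap φ U z₀) {n : ℕ} (hL : DifferentiableOn ℂ L U)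
    (hn : ‖deriv φ z₀ ^ n • L z₀‖ < 1)
    (hres : ∀ k : ℕ, IsUnit (1 - deriv φ z₀ ^ k • L z₀)) {h : ℂ → E}
    (hh : DifferentiableOn ℂ h U) (heq : ∀ z ∈ U, h z = weightedComp L φ h z) :
    ∀ z ∈ U, h z = 0 := by
  induction n generalizing L h with
  | zero =>
    exact fun z => hφ.eq_zero_of_eq_weightedComp_of_norm_lt_one hL.continuousOn
      (by simpa using hn) hh.continuousOn heq
  | succ n ih =>
    have h₀ : h z₀ = 0 := by
      obtain ⟨R, hR⟩ := (hres 0).exists_left_inv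
      have hker : L z₀ (h z₀) = h z₀ := by
        simpa [weightedComp, hφ.fixed] using (heq z₀ hφ.mem).symm
      simpa [hker] using congr($hR.symm (h z₀))
    exact fun z hz => eq_zero_of_dslope_eq_zero h₀ <| ih (hφ.differentiableOn_dslope_smul hL)
      (by rwa [pow_deriv_smul_dslope_smul_apply])
      (fun k => by rw [pow_deriv_smul_dslope_smul_apply]; exact hres (k + 1))
      ((Complex.differentiableOn_dslope hφ.mem_nhds).2 hh)
      (hφ.dslope_eq_weightedComp hL.continuousOn hh h₀ heq) z hz

theorem IsAttractingSelfMap.eq_zero_of_eq_weightedComp (hφ : IsAttractingSelfMap φ U z₀)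
    (hL : DifferentiableOn ℂ L U)
    (hres : ∀ k : ℕ, 1 ≤ k → IsUnit (1 - deriv φ z₀ ^ k • L z₀)) {h : ℂ → E}
    (hh : DifferentiableOn ℂ h U) (h₀ : h z₀ = 0) (heq : ∀ z ∈ U, h z = weightedComp L φ h z)
    {z : ℂ} (hz : z ∈ U) : h z = 0 := by
  obtain ⟨n, hn⟩ := hφ.exists_norm_pow_smul_lt_one ((dslope φ z₀ • L) z₀)
  refine eq_zero_of_dslope_eq_zero h₀ <|
    hφ.eq_zero_of_eq_weightedComp_of_norm_pow_smul_lt_one (hφ.differentiableOn_dslope_smul hL) hn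
      (fun k => ?_) ((Complex.differentiableOn_dslope hφ.mem_nhds).2 hh)
      (hφ.dslope_eq_weightedComp hL.continuousOn hh h₀ heq) z hz
  rw [pow_deriv_smul_dslope_smul_apply]
  exact hres (k + 1) k.succ_pos

theorem IsAttractingSelfMap.exists_eq_add_weightedComp_of_norm_pow_smul_lt_one
    (hφ : IsAttractingSelfMap φ U z₀) {n : ℕ} (hL : DifferentiableOn ℂ L U)
    (hn : ‖deriv φ z₀ ^ n • L z₀‖ < 1)
    (hres : ∀ k : ℕ, IsUnit (1 - deriv φ z₀ ^ k • L z₀)) {w : ℂ → E}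
    (hw : DifferentiableOn ℂ w U) :
    ∃ g, DifferentiableOn ℂ g U ∧ ∀ z ∈ U, g z = w z + weightedComp L φ g z := by
  induction n generalizing L w with
  | zero => exact hφ.exists_eq_add_weightedComp_of_norm_lt_one hL (by simpa using hn) hw
  | succ n ih =>
    obtain ⟨c, hc⟩ : ∃ c, w z₀ + L z₀ c = c := by
      obtain ⟨R, hR⟩ := (hres 0).exists_right_inv
      refine ⟨R (w z₀), ?_⟩
      rw [← eq_sub_iff_add_eq]
      simpa using congr($hR.symm (w z₀))
    have hslope : DifferentiableOn ℂ (dslope (fun x => w x + L x c) z₀) U :=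
      (Complex.differentiableOn_dslope hφ.mem_nhds).2
        (hw.add (hL.clm_apply (differentiableOn_const c)))
    obtain ⟨g, hg, hgeq⟩ := ih (hφ.differentiableOn_dslope_smul hL)
      (by rwa [pow_deriv_smul_dslope_smul_apply])
      (fun k => by rw [pow_deriv_smul_dslope_smul_apply]; exact hres (k + 1)) hslope
    exact ⟨fun x => c + (x - z₀) • g x, by fun_prop, fun z hz =>
      eq_add_weightedComp_of_dslope hφ.fixed hc (hgeq z hz)⟩

theorem IsAttractingSelfMap.exists_eq_weightedComp (hφ : IsAttractingSelfMap φ U z₀)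
    (hL : DifferentiableOn ℂ L U)
    (hres : ∀ k : ℕ, 1 ≤ k → IsUnit (1 - deriv φ z₀ ^ k • L z₀)) {v : E} (hv : L z₀ v = v) :
    ∃ h, DifferentiableOn ℂ h U ∧ h z₀ = v ∧ ∀ z ∈ U, h z = weightedComp L φ h z := by
  obtain ⟨n, hn⟩ := hφ.exists_norm_pow_smul_lt_one ((dslope φ z₀ • L) z₀)
  have hslope : DifferentiableOn ℂ (dslope (fun x => (0 : ℂ → E) x + L x v) z₀) U :=
    (Complex.differentiableOn_dslope hφ.mem_nhds).2
      ((differentiableOn_const 0).add (hL.clm_apply (differentiableOn_const v)))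
  obtain ⟨g, hg, hgeq⟩ := hφ.exists_eq_add_weightedComp_of_norm_pow_smul_lt_one
    (hφ.differentiableOn_dslope_smul hL) hn
    (fun k => by rw [pow_deriv_smul_dslope_smul_apply]; exact hres (k + 1) k.succ_pos) hslope
  refine ⟨fun x => v + (x - z₀) • g x, by fun_prop, by simp, fun z hz => ?_⟩
  simpa using eq_add_weightedComp_of_dslope (w := 0) hφ.fixed (by simpa using hv) (hgeq z hz)

end WeightedComposition

section Flow

variable {F : ℝ → ℂ → ℂ} {f : ℂ → ℂ} {z₀ : ℂ}

theorem IsHolSemigroup.continuousOn_orbit (hF : IsHolSemigroup F) {z : ℂ}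
    (hz : z ∈ ball (0 : ℂ) 1) : ContinuousOn (fun t => F t z) (Ici 0) :=
  hF.continuousOn.comp (f := fun t : ℝ => (t, z)) (by fun_prop) fun _ ht => ⟨ht, hz⟩

theorem IsHolGenerator.hasDerivWithinAt (hf : IsHolGenerator F f) (hF : IsHolSemigroup F)
    {z : ℂ} (hz : z ∈ ball (0 : ℂ) 1) {t : ℝ} (ht : 0 ≤ t) :
    HasDerivWithinAt (fun s => F s z) (f (F t z)) (Ici t) t := by
  have hw := hF.mapsTo t ht hz
  have hzero : HasDerivWithinAt (fun s => F s (F t z)) (f (F t z)) (Ici 0) 0 := by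
    rw [hasDerivWithinAt_iff_tendsto_slope, Ici_sdiff_left]
    refine (hf.tendsto _ hw).congr fun s => ?_
    rw [slope_def_module, hF.zero _ hw, sub_zero, div_eq_inv_mul, ← Complex.ofReal_inv,
      Complex.real_smul]
  exact hasDerivWithinAt_Ici_of_shift <|
    hzero.congr (fun s hs => hF.add s t hs ht z hz) (hF.add 0 t le_rfl ht z hz)

theorem IsHolGenerator.continuousOn_dslope (hf : IsHolGenerator F f)
    (hz₀ : z₀ ∈ ball (0 : ℂ) 1) : ContinuousOn (dslope f z₀) (ball 0 1) :=
  ((Complex.differentiableOn_dslope (isOpen_ball.mem_nhds hz₀)).2 hf.holomorphic).continuousOn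

theorem IsHolGenerator.sub_eq_mul_exp_integral (hf : IsHolGenerator F f) (hF : IsHolSemigroup F)
    (hz₀ : z₀ ∈ ball (0 : ℂ) 1) (hfz₀ : f z₀ = 0) {z : ℂ} (hz : z ∈ ball (0 : ℂ) 1) {t : ℝ}
    (ht : 0 ≤ t) :
    F t z - z₀ = (z - z₀) * Complex.exp (∫ s in 0..t, dslope f z₀ (F s z)) := by
  set a : ℝ → ℂ := fun s => dslope f z₀ (F s z)
  have hac : ContinuousOn a (Ici 0) := (hf.continuousOn_dslope hz₀).comp
    (hF.continuousOn_orbit hz) fun s hs => hF.mapsTo s hs hz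
  have hint : ∀ s ∈ Ico 0 t, HasDerivWithinAt (fun r => ∫ x in 0..r, a x) (a s) (Ici s) s :=
    fun s hs => hasDerivWithinAt_integral_Ici hac hs.1
  have hcont : ContinuousOn (fun s => ∫ x in 0..s, a x) (Icc 0 t) :=
    intervalIntegral.continuousOn_primitive_interval'
      (ContinuousOn.intervalIntegrable_of_Icc ht (hac.mono Icc_subset_Ici_self))
      left_mem_uIcc |>.mono (uIcc_of_le ht).symm.subset
  have hconst := constant_of_has_deriv_right_zero
    (f := fun s => (F s z - z₀) * Complex.exp (-∫ x in 0..s, a x)) (a := 0) (b := t)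
    ((((hF.continuousOn_orbit hz).mono Icc_subset_Ici_self).sub continuousOn_const).mul
      hcont.neg.cexp)
    (fun s hs => by
      refine (((hf.hasDerivWithinAt hF hz hs.1).sub_const z₀).mul
        (hint s hs).neg.cexp).congr_deriv ?_
      have hslope := sub_smul_dslope f z₀ (F s z)
      rw [hfz₀, sub_zero, smul_eq_mul] at hslope
      rw [← hslope]
      ring) t ⟨ht, le_rfl⟩
  rw [Complex.exp_neg, ← div_eq_mul_inv, div_eq_iff (Complex.exp_ne_zero _)] at hconst
  simpa [hF.zero z hz] using hconst

theorem IsHolGenerator.apply_eq_self (hf : IsHolGenerator F f) (hF : IsHolSemigroup F)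
    (hz₀ : z₀ ∈ ball (0 : ℂ) 1) (hfz₀ : f z₀ = 0) {t : ℝ} (ht : 0 ≤ t) : F t z₀ = z₀ := by
  simpa [sub_eq_zero] using hf.sub_eq_mul_exp_integral hF hz₀ hfz₀ hz₀ ht

theorem IsHolSemigroup.continuousOn_integral_comp {E : Type*} [NormedAddCommGroup E]
    [NormedSpace ℝ E] (hF : IsHolSemigroup F) {g : ℂ → E} (hg : ContinuousOn g (ball 0 1)) {t : ℝ}
    (ht : 0 ≤ t) : ContinuousOn (fun z => ∫ s in 0..t, g (F s z)) (ball 0 1) := by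
  have hcomp : ContinuousOn (fun p : ℝ × ℂ => g (F p.1 p.2)) (Ici 0 ×ˢ ball 0 1) :=
    hg.comp hF.continuousOn fun p hp => hF.mapsTo p.1 hp.1 hp.2
  have hext : Continuous (Function.uncurry fun (z : ball (0 : ℂ) 1) s => g (F (max s 0) z)) :=
    hcomp.comp_continuous (f := fun p : ball (0 : ℂ) 1 × ℝ => (max p.2 0, (p.1 : ℂ)))
      (by fun_prop) fun p => ⟨mem_Ici.2 (le_max_right _ _), p.1.2⟩
  rw [continuousOn_iff_continuous_domRestrict]
  refine (intervalIntegral.continuous_parametric_intervalIntegral_of_continuous' hext 0 t).congr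
    fun z => intervalIntegral.integral_congr fun s hs => ?_
  rw [uIcc_of_le ht] at hs
  simp only [max_eq_left hs.1]

theorem IsHolGenerator.hasDerivAt_flow (hf : IsHolGenerator F f) (hF : IsHolSemigroup F)
    (hz₀ : z₀ ∈ ball (0 : ℂ) 1) (hfz₀ : f z₀ = 0) {t : ℝ} (ht : 0 ≤ t) :
    HasDerivAt (F t) (Complex.exp (deriv f z₀ * t)) z₀ := by
  have hnhds : ball (0 : ℂ) 1 ∈ 𝓝 z₀ := isOpen_ball.mem_nhds hz₀
  set q : ℂ → ℂ := fun z => Complex.exp (∫ s in 0..t, dslope f z₀ (F s z)) with hq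
  have hqc : ContinuousAt q z₀ :=
    (((hF.continuousOn_integral_comp (hf.continuousOn_dslope hz₀) ht).continuousAt hnhds)).cexp
  have hq₀ : q z₀ = Complex.exp (deriv f z₀ * t) := by
    have hint : ∫ s in 0..t, dslope f z₀ (F s z₀) = ∫ _ in 0..t, deriv f z₀ :=
      intervalIntegral.integral_congr fun s hs => by
        rw [uIcc_of_le ht] at hs
        simp only [hf.apply_eq_self hF hz₀ hfz₀ hs.1, dslope_same]
    simp only [hq, hint, intervalIntegral.integral_const, sub_zero, Complex.real_smul, mul_comm]
  rw [← hq₀, hasDerivAt_iff_tendsto_slope]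
  refine (hqc.tendsto.mono_left nhdsWithin_le_nhds).congr' ?_
  filter_upwards [mem_nhdsWithin_of_mem_nhds hnhds, self_mem_nhdsWithin] with z hz hne
  rw [slope_def_field, hf.apply_eq_self hF hz₀ hfz₀ ht,
    hf.sub_eq_mul_exp_integral hF hz₀ hfz₀ hz ht, mul_div_cancel_left₀ _ (sub_ne_zero.2 hne)]

theorem IsHolGenerator.isAttractingSelfMap (hf : IsHolGenerator F f) (hF : IsHolSemigroup F)
    (hz₀ : z₀ ∈ ball (0 : ℂ) 1) (hfz₀ : f z₀ = 0) (hre : (deriv f z₀).re < 0) {t : ℝ}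
    (ht : 0 < t) : IsAttractingSelfMap (F t) (ball 0 1) z₀ := by
  refine .of_isBounded isOpen_ball (convex_ball 0 1).isPreconnected isBounded_ball
    (hF.holomorphic t ht.le) (hF.mapsTo t ht.le) hz₀ (hf.apply_eq_self hF hz₀ hfz₀ ht.le) ?_
  rw [(hf.hasDerivAt_flow hF hz₀ hfz₀ ht.le).deriv, Complex.norm_exp, Complex.re_mul_ofReal]
  exact Real.exp_lt_one_iff.2 (mul_neg_of_neg_of_pos hre ht)

end Flow

section Semicocycle

open NormedSpace ContinuousLinearMap

variable {A : Type*} [NormedRing A] [NormedAlgebra ℂ A] {F : ℝ → ℂ → ℂ} {Γ : ℝ → ℂ → A}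
  {z₀ : ℂ} {b : A} {M : ℂ → A}

theorem IsHolSemicocycle.isNormContinuousSemigroup (hΓ : IsHolSemicocycle F Γ)
    (hz₀ : z₀ ∈ ball (0 : ℂ) 1) (hfix : ∀ t, 0 ≤ t → F t z₀ = z₀) :
    IsNormContinuousSemigroup fun t => Γ t z₀ where
  continuousOn := hΓ.continuousOn.comp (f := fun t : ℝ => (t, z₀)) (by fun_prop)
    fun _ ht => ⟨ht, hz₀⟩
  zero := hΓ.zero z₀ hz₀
  add s t hs ht := by rw [← hΓ.chain s t hs ht z₀ hz₀, hfix t ht]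

theorem IsHolSemicocycle.eventually_forall_isUnit [CompleteSpace A] (hΓ : IsHolSemicocycle F Γ)
    {K : Set ℂ} (hK : IsCompact K) (hKD : K ⊆ ball 0 1) :
    ∀ᶠ t in 𝓝[≥] (0 : ℝ), ∀ z ∈ K, IsUnit (Γ t z) := by
  have hnear : ∀ᶠ t in 𝓝 (0 : ℝ), ∀ z ∈ K, 0 ≤ t → IsUnit (Γ t z) := by
    refine hK.eventually_forall_of_forall_eventually fun w hw => ?_
    have hunit : ∀ᶠ p in 𝓝[Ici 0 ×ˢ ball 0 1] ((0 : ℝ), w), IsUnit (Γ p.1 p.2) :=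
      (hΓ.continuousOn (0, w) ⟨self_mem_Ici, hKD hw⟩).eventually
        (Units.isOpen.mem_nhds (by simp [hΓ.zero w (hKD hw)]))
    filter_upwards [eventually_nhdsWithin_iff.1 hunit,
      continuous_snd.continuousAt.eventually (isOpen_ball.mem_nhds (hKD hw))] with p hp hpD hp₀
    exact hp ⟨hp₀, hpD⟩
  filter_upwards [nhdsWithin_le_nhds hnear, self_mem_nhdsWithin] with t ht ht₀ z hz
  exact ht z hz ht₀

theorem IsHolSemicocycle.isUnit [CompleteSpace A] (hΓ : IsHolSemicocycle F Γ)
    (hF : IsHolSemigroup F) {z : ℂ} (hz : z ∈ ball (0 : ℂ) 1) {t : ℝ} (ht : 0 ≤ t) :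
    IsUnit (Γ t z) := by
  have horbit : IsCompact ((fun s => F s z) '' Icc 0 t) :=
    isCompact_Icc.image_of_continuousOn ((hF.continuousOn_orbit hz).mono Icc_subset_Ici_self)
  have hsmall := hΓ.eventually_forall_isUnit horbit <|
    image_subset_iff.2 fun s hs => hF.mapsTo s hs.1 hz
  have hlim : Tendsto (fun n : ℕ => t / n) atTop (𝓝[≥] 0) :=
    tendsto_nhdsWithin_iff.2 ⟨tendsto_const_div_atTop_nhds_zero_nat t,
      Eventually.of_forall fun n => div_nonneg ht n.cast_nonneg⟩
  obtain ⟨n, hn, hn₀⟩ := ((hlim.eventually hsmall).and (eventually_gt_atTop 0)).exists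
  have hstep : 0 ≤ t / n := div_nonneg ht n.cast_nonneg
  have hn₀' : (0 : ℝ) < n := Nat.cast_pos.2 hn₀
  have hmul (k : ℕ) (hk : k ≤ n) : IsUnit (Γ (k * (t / n)) z) := by
    induction k with
    | zero => simp [hΓ.zero z hz]
    | succ k ih =>
      have hkt : k * (t / n) ≤ t := by
        rw [mul_div_assoc', div_le_iff₀ hn₀', mul_comm]
        gcongr
        exact (Nat.le_succ k).trans hk
      have hk₀ : 0 ≤ k * (t / n) := mul_nonneg k.cast_nonneg hstep
      rw [Nat.cast_succ, add_one_mul, add_comm, ← hΓ.chain _ _ hstep hk₀ z hz]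
      exact (hn _ (mem_image_of_mem _ ⟨hk₀, hkt⟩)).mul (ih (Nat.le_of_succ_le hk))
  simpa [mul_div_cancel₀ t hn₀'.ne'] using hmul n le_rfl

/-- The weight `x ↦ exp (-t b) * x * Γ t z`. A map `M` linearizes the semicocycle exactly when it
is invertible and fixed by the weighted composition operators over `F t` with these weights. -/
noncomputable def transferWeight (Γ : ℝ → ℂ → A) (b : A) (t : ℝ) (z : ℂ) : A →L[ℂ] A :=
  mul ℂ A (exp (-(t • b))) ∘L (mul ℂ A).flip (Γ t z)

theorem transferWeight_apply (t : ℝ) (z : ℂ) (x : A) :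
    transferWeight Γ b t z x = exp (-(t • b)) * x * Γ t z := by
  simp [transferWeight, mul_assoc]

theorem IsHolSemicocycle.differentiableOn_transferWeight (hΓ : IsHolSemicocycle F Γ) {t : ℝ}
    (ht : 0 ≤ t) : DifferentiableOn ℂ (transferWeight Γ b t) (ball 0 1) :=
  (differentiableOn_const _).clm_comp
    ((mul ℂ A).flip.differentiable.comp_differentiableOn (hΓ.holomorphic t ht))

theorem transferWeight_eq_exp_adOp [CompleteSpace A] {t : ℝ}
    (hval : Γ t z₀ = exp (t • b)) : transferWeight Γ b t z₀ = exp (t • adOp b) := by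
  ext x
  rw [transferWeight_apply, ← adOp_smul, exp_adOp_apply, hval]

theorem IsHolSemicocycle.weightedComp_weightedComp [CompleteSpace A] (hΓ : IsHolSemicocycle F Γ)
    (hF : IsHolSemigroup F) {s t : ℝ} (hs : 0 ≤ s) (ht : 0 ≤ t) {z : ℂ}
    (hz : z ∈ ball (0 : ℂ) 1) :
    weightedComp (transferWeight Γ b s) (F s) (weightedComp (transferWeight Γ b t) (F t) M) z =
      weightedComp (transferWeight Γ b (s + t)) (F (s + t)) M z := by
  simp only [weightedComp, transferWeight_apply, ← smul_neg]
  rw [exp_add_smul, add_comm s t, hF.add t s ht hs z hz, ← hΓ.chain t s ht hs z hz]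
  simp only [mul_assoc]

theorem IsHolSemicocycle.exists_forall_eq_weightedComp [CompleteSpace A]
    (hΓ : IsHolSemicocycle F Γ) (hF : IsHolSemigroup F) (hfix : ∀ t, 0 ≤ t → F t z₀ = z₀)
    (hval : ∀ t, 0 ≤ t → Γ t z₀ = exp (t • b)) {τ : ℝ} (hτ : 0 ≤ τ)
    (hφ : IsAttractingSelfMap (F τ) (ball 0 1) z₀)
    (hres : ∀ k : ℕ, 1 ≤ k → IsUnit (1 - deriv (F τ) z₀ ^ k • exp (τ • adOp b))) :
    ∃ M, DifferentiableOn ℂ M (ball 0 1) ∧ M z₀ = 1 ∧ ∀ t, 0 ≤ t → ∀ z ∈ ball (0 : ℂ) 1,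
      M z = weightedComp (transferWeight Γ b t) (F t) M z := by
  have hone (t : ℝ) (ht : 0 ≤ t) : transferWeight Γ b t z₀ 1 = 1 := by
    rw [transferWeight_apply, hval t ht, mul_one, exp_neg_mul_exp]
  have hLτ := hΓ.differentiableOn_transferWeight (b := b) hτ
  rw [← transferWeight_eq_exp_adOp (hval τ hτ)] at hres
  obtain ⟨M, hM, hM₀, hMτ⟩ := hφ.exists_eq_weightedComp hLτ hres (hone τ hτ)
  refine ⟨M, hM, hM₀, fun t ht z hz => sub_eq_zero.1 ?_⟩
  set T : (ℂ → A) → ℂ → A := weightedComp (transferWeight Γ b t) (F t) with hT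
  have hTM : DifferentiableOn ℂ (T M) (ball 0 1) :=
    differentiableOn_weightedComp (hΓ.differentiableOn_transferWeight ht) (hF.holomorphic t ht)
      (hF.mapsTo t ht) hM
  have hTM₀ : T M z₀ = 1 := by rw [hT, weightedComp, hfix t ht, hM₀, hone t ht]
  have hcomm (w : ℂ) (hw : w ∈ ball (0 : ℂ) 1) :
      T M w = weightedComp (transferWeight Γ b τ) (F τ) (T M) w := by
    rw [hT, hΓ.weightedComp_weightedComp hF hτ ht hw, add_comm,
      ← hΓ.weightedComp_weightedComp hF ht hτ hw, weightedComp, weightedComp,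
      ← hMτ _ (hF.mapsTo t ht hw)]
  refine hφ.eq_zero_of_eq_weightedComp hLτ hres (hM.sub hTM)
    (by rw [Pi.sub_apply, hM₀, hTM₀, sub_self]) (fun w hw => ?_) hz
  rw [weightedComp, Pi.sub_apply, Pi.sub_apply, map_sub, hMτ w hw, hcomm w hw]
  rfl

theorem IsHolSemicocycle.isLinearization [CompleteSpace A] (hΓ : IsHolSemicocycle F Γ)
    (hF : IsHolSemigroup F) {τ : ℝ} (hτ : 0 ≤ τ) (hφ : IsAttractingSelfMap (F τ) (ball 0 1) z₀)
    (hM : DifferentiableOn ℂ M (ball 0 1)) (hM₀ : IsUnit (M z₀))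
    (hinv : ∀ t, 0 ≤ t → ∀ z ∈ ball (0 : ℂ) 1,
      M z = weightedComp (transferWeight Γ b t) (F t) M z) :
    IsLinearization F Γ b M := by
  have hexp (t : ℝ) : IsUnit (exp (-(t • b))) :=
    ⟨⟨_, _, exp_neg_mul_exp _, exp_mul_exp_neg _⟩, rfl⟩
  have hunit (z : ℂ) (hz : z ∈ ball (0 : ℂ) 1) : IsUnit (M z) := by
    refine hφ.backward_induction (P := fun z => IsUnit (M z))
      ((hM.continuousOn.continuousAt hφ.mem_nhds).eventually (Units.isOpen.mem_nhds hM₀))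
      (fun w hw hFw => ?_) hz
    rw [hinv τ hτ w hw, weightedComp, transferWeight_apply]
    exact ((hexp τ).mul hFw).mul (hΓ.isUnit hF hw hτ)
  refine ⟨hM, hunit, fun t ht z hz => ?_⟩
  rw [hinv t ht z hz, weightedComp, transferWeight_apply, Complex.coe_smul, mul_assoc, mul_assoc,
    ← mul_assoc (exp (t • b)), exp_mul_exp_neg, one_mul,
    Ring.inverse_mul_cancel_left _ _ (hunit _ (hF.mapsTo t ht hz))]

end Semicocycle

theorem theorem3p9 {A : Type*} [NormedRing A] [NormedAlgebra ℂ A] [CompleteSpace A]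
    [NormOneClass A]
    (F : ℝ → ℂ → ℂ) (hF : IsHolSemigroup F)
    (f : ℂ → ℂ) (hf : IsHolGenerator F f)
    (z₀ : ℂ) (hz₀ : z₀ ∈ Metric.ball (0 : ℂ) 1) (hfz₀ : f z₀ = 0)
    (lam : ℂ) (hlam : lam = -deriv f z₀) (hre : 0 < lam.re)
    (Γ : ℝ → ℂ → A) (hΓ : IsHolSemicocycle F Γ)
    (B₀ : A) (hB₀ : B₀ = semicocycleGenerator Γ z₀) :
    DifferentiableWithinAt ℝ (fun t : ℝ => Γ t z₀) (Set.Ici 0) 0 ∧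
      (spectrum ℂ (adOp B₀) ∩ {μ : ℂ | ∃ k : ℕ, 1 ≤ k ∧ μ = lam * (k : ℂ)} = ∅ →
        ∃ M : ℂ → A, IsLinearization F Γ B₀ M) := by
  have hfix (t : ℝ) (ht : 0 ≤ t) : F t z₀ = z₀ := hf.apply_eq_self hF hz₀ hfz₀ ht
  have hS := hΓ.isNormContinuousSemigroup hz₀ hfix
  refine ⟨hS.differentiableWithinAt_zero, fun hspec => ?_⟩
  have hB : HasDerivWithinAt (fun t => Γ t z₀) B₀ (Ici 0) 0 := by
    rw [hB₀]
    exact hS.differentiableWithinAt_zero.hasDerivWithinAt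
  have : Nontrivial A := NormOneClass.nontrivial
  obtain ⟨τ, hτ, hres⟩ := exists_forall_isUnit_one_sub_exp_smul hre fun k hk hmem =>
    eq_empty_iff_forall_notMem.1 hspec _ ⟨hmem, k, hk, rfl⟩
  have hφ := hf.isAttractingSelfMap hF hz₀ hfz₀ (by simpa [hlam] using hre) hτ
  have hmult : deriv (F τ) z₀ = Complex.exp (-lam * τ) := by
    rw [(hf.hasDerivAt_flow hF hz₀ hfz₀ hτ.le).deriv, hlam, neg_neg]
  obtain ⟨M, hM, hM₀, hinv⟩ := hΓ.exists_forall_eq_weightedComp hF hfix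
    (fun t ht => hS.eq_exp hB ht) hτ.le hφ (by rwa [hmult])
  exact ⟨M, hΓ.isLinearization hF hτ.le hφ hM (hM₀ ▸ isUnit_one) hinv⟩
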